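/- Let $(R,\mathfrak m,k)$ be a commutative Noetherian local ring with $\mathfrak m^4=0$, and let $M$ be a finitely generated $R$-module with minimal free resolution $\mathbf F=(F_i,\partial_i)_{i\ge 0}$ and Betti numbers $b_i=\operatorname{rank}_R F_i=\dim_k\operatorname{Tor}_i^R(M,k)$. Let $\operatorname{gr}_{\mathfrak m}(\mathbf F)=\bigoplus_{j\in\mathbb Z}\operatorname{gr}_{\mathfrak m}(\mathbf F)^j$ be the associated graded complex, whose component $\operatorname{gr}_{\mathfrak m}(\mathbf F)^j$ is, in homological degree $i$, the module $\mathfrak m^{j-i}F_i/\mathfrak m^{j-i+1}F_i$ (where $\mathfrak m^n=R$ for $n\le 0$), with differentials induced by those of $\mathbf F$. Suppose that $\mathbf F$ is eventually linear, that is, there is an integer $n\ge 0$ such that $\operatorname{H}_i(\operatorname{gr}_{\mathfrak m}(\mathbf F))=0$ for all $i\ge n$. If $\operatorname{Ext}^i_R(M,R)=0$ for all $i\gg 0$, then the Betti sequence $\{b_i\}_{i\ge 0}$ is not eventually periodic of period two and not eventually periodic of period three. Here a sequence $\{b_i\}$ is called eventually periodic of period $p$ if $p$ is the least positive integer such that $b_{i+p}=b_i$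 for all $i\gg 0$ (so an eventually constant sequence has period one). -/

import Mathlib

open CategoryTheory IsLocalRing Filter

universe u

section LinearPart

variable (R : Type u) [CommRing R] [IsLocalRing R]

/-- The step `𝔪 ^ a N` of the `𝔪`-adic filtration of `N`, where `𝔪 ^ a = R` for `a ≤ 0`. -/
def madicFiltration (a : ℤ) (N : Type u) [AddCommGroup N] [Module R N] : Submodule R N :=
  (maximalIdeal R ^ a.toNat) • (⊤ : Submodule R N)

/-- The graded piece `𝔪 ^ a N / 𝔪 ^ (a + 1) N`; it is zero for `a < 0`. -/
abbrev GrPiece (a : ℤ) (N : Type u) [AddCommGroup N] [Module R N] : Type u :=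
  madicFiltration R a N ⧸ (madicFiltration R (a + 1) N).submoduleOf (madicFiltration R a N)

variable {R}

lemma madicFiltration_map {N N' : Type u} [AddCommGroup N] [Module R N] [AddCommGroup N']
    [Module R N'] (f : N →ₗ[R] N') (hf : LinearMap.range f ≤ maximalIdeal R • ⊤)
    {a b : ℤ} (h : b = a + 1) {x : N} (hx : x ∈ madicFiltration R a N) :
    f x ∈ madicFiltration R b N' := by
  subst h
  have h1 : f x ∈ (maximalIdeal R ^ a.toNat) • LinearMap.range f := by
    have := Submodule.mem_map_of_mem (f := f) hx
    rwa [madicFiltration, Submodule.map_smul'', Submodule.map_top] at this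
  have h2 : f x ∈ (maximalIdeal R ^ (a.toNat + 1)) • (⊤ : Submodule R N') := by
    rw [pow_succ, mul_smul]
    exact Submodule.smul_mono le_rfl hf h1
  exact Submodule.smul_mono (Ideal.pow_le_pow_right (by omega)) le_rfl h2

/-- The map `𝔪 ^ a N / 𝔪 ^ (a + 1) N → 𝔪 ^ (a + 1) N' / 𝔪 ^ (a + 2) N'` induced by a linear map
`f : N → N'` with `f N ⊆ 𝔪 N'`. (The index `a + 1` is called `b`.) -/
def grMap {N N' : Type u} [AddCommGroup N] [Module R N] [AddCommGroup N'] [Module R N']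
    (f : N →ₗ[R] N') (hf : LinearMap.range f ≤ maximalIdeal R • ⊤) (a b : ℤ) (h : b = a + 1) :
    GrPiece R a N →ₗ[R] GrPiece R b N' :=
  Submodule.mapQ _ _
    (f.restrict (p := madicFiltration R a N) (q := madicFiltration R b N')
      (fun _ hx => madicFiltration_map f hf h hx))
    (fun _ hx => madicFiltration_map f hf (by rw [h]) hx)

/-- A complex is minimal if its differentials have image in `𝔪` times the target. -/
def IsMinimalComplex (C : ChainComplex (ModuleCat.{u} R) ℕ) : Prop :=
  ∀ i j, LinearMap.range (C.d i j).hom ≤ maximalIdeal R • (⊤ : Submodule R (C.X j))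

/-- The `j`-th strand of the associated graded complex (linear part) of a minimal complex `C`:
in homological degree `i` it is `𝔪 ^ (j - i) C_i / 𝔪 ^ (j - i + 1) C_i`, and its differential is
induced by that of `C`. -/
noncomputable def grComplex (C : ChainComplex (ModuleCat.{u} R) ℕ) (hC : IsMinimalComplex C)
    (j : ℤ) : ChainComplex (ModuleCat.{u} R) ℕ where
  X i := ModuleCat.of R (GrPiece R (j - i) (C.X i))
  d i i' :=
    if h : i' + 1 = i then
      ModuleCat.ofHom
        (grMap (C.d i i').hom (hC i i') (j - i) (j - i') (by rw [← h]; push_cast; ring))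
    else 0
  shape i i' h := dif_neg h
  d_comp_d' i i' i'' h h' := by
    have h1 : i' + 1 = i := h
    have h2 : i'' + 1 = i' := h'
    rw [dif_pos h1, dif_pos h2]
    ext x
    have hz : (C.d i' i'').hom ((C.d i i').hom x.1) = 0 := by
      rw [← LinearMap.comp_apply, ← ModuleCat.hom_comp, C.d_comp_d]
      rfl
    refine (Submodule.Quotient.mk_eq_zero _).mpr ?_
    rw [Submodule.submoduleOf, Submodule.mem_comap]
    change (C.d i' i'').hom ((C.d i i').hom x.1) ∈ madicFiltration R _ _
    rw [hz]
    exact Submodule.zero_mem _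

end LinearPart

/-- A minimal free resolution of the `R`-module `M`, by finitely generated free modules. -/
structure MinimalFreeResolution (R : Type u) [CommRing R] [IsLocalRing R]
    (M : Type u) [AddCommGroup M] [Module R M] where
  resolution : ProjectiveResolution (ModuleCat.of R M)
  free : ∀ n, Module.Free R (resolution.complex.X n)
  finite : ∀ n, Module.Finite R (resolution.complex.X n)
  minimal : IsMinimalComplex resolution.complex

namespace MinimalFreeResolution

variable {R : Type u} [CommRing R] [IsLocalRing R] {M : Type u} [AddCommGroup M] [Module R M]

/-- The Betti sequence of `M`: the ranks of the modules in a minimal free resolution of `M`. -/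
noncomputable def betti (F : MinimalFreeResolution R M) (n : ℕ) : ℕ :=
  Module.finrank R (F.resolution.complex.X n)

/-- The linearity defect: the least `n` such that the homology of the associated graded complex
vanishes in all homological degrees `i ≥ n`, and `⊤` if there is no such `n`. -/
noncomputable def linearityDefect (F : MinimalFreeResolution R M) : ℕ∞ :=
  ⨅ (n : ℕ) (_ : ∀ i ≥ n, ∀ j : ℤ,
    Limits.IsZero ((grComplex F.resolution.complex F.minimal j).homology i)), (n : ℕ∞)

/-- A minimal free resolution is eventually linear if its linearity defect is finite. -/
def IsEventuallyLinear (F : MinimalFreeResolution R M) : Prop :=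
  F.linearityDefect ≠ ⊤

end MinimalFreeResolution

/-- The sequence `b` is eventually periodic of (exact) period `p`: `p` is the least positive
integer `q` such that `b (i + q) = b i` for all large `i`. -/
def IsEventuallyPeriodicOfPeriod (b : ℕ → ℕ) (p : ℕ) : Prop :=
  IsLeast {q : ℕ | 0 < q ∧ ∀ᶠ i in atTop, b (i + q) = b i} p

/-! Write `e_a` for the length of `𝔪^a/𝔪^(a+1)`. As `𝔪^4 = 0`, a strand of the linear part has at
most four nonzero terms, `0 → gr⁰F_{k+3} → gr¹F_{k+2} → gr²F_{k+1} → gr³F_k → 0`. It is exact for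
large `k`, so its Euler characteristic gives `e₀b_{k+3} - e₁b_{k+2} + e₂b_{k+1} - e₃b_k = 0`
(`eventually_betti_recurrence`). A nonconstant solution of period two or three needs a root of `e₀t³
- e₁t² + e₂t - e₃` at `-1` or at a primitive cube root of unity `ω`. The value at `-1` is `-(e₀ + e₁
+ e₂ + e₃) < 0`. The value at `ω` vanishes only if `e₀ - e₃ = e₂ = -e₁`, so `e₁ = e₂ = 0` and `e₀ =
e₃`; but `e₁ = 0` forces `𝔪 = 0`, hence `e₃ = 0 < e₀`. The Betti sequence would then be eventually
constant, of period one. -/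

section FiniteLength

variable (R : Type u) [CommRing R]

/-- The length of a module as a natural number; it is meaningful for modules of finite length. -/
noncomputable def natLength (N : Type u) [AddCommGroup N] [Module R N] : ℕ :=
  (Module.length R N).toNat

variable {R}

lemma LinearEquiv.natLength_eq {N P : Type u} [AddCommGroup N] [Module R N] [AddCommGroup P]
    [Module R P] (e : N ≃ₗ[R] P) : natLength R N = natLength R P := by
  rw [natLength, natLength, e.length_eq]

lemma natLength_eq_zero (N : Type u) [AddCommGroup N] [Module R N] [Subsingleton N] :
    natLength R N = 0 := by
  simp [natLength]

variable [IsArtinianRing R]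

lemma coe_natLength (N : Type u) [AddCommGroup N] [Module R N] [Module.Finite R N] :
    (natLength R N : ℕ∞) = Module.length R N :=
  ENat.natCast_toNat Module.length_ne_top

lemma natLength_quotient_add {N : Type u} [AddCommGroup N] [Module R N] [Module.Finite R N]
    (P : Submodule R N) : natLength R P + natLength R (N ⧸ P) = natLength R N := by
  have h := Module.length_eq_add_of_exact P.subtype P.mkQ P.subtype_injective
    P.mkQ_surjective (LinearMap.exact_subtype_mkQ P)
  simp only [← coe_natLength] at h
  exact_mod_cast h.symm

lemma natLength_ker_add_range {N P : Type u} [AddCommGroup N] [Module R N] [Module.Finite R N]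
    [AddCommGroup P] [Module R P] (f : N →ₗ[R] P) :
    natLength R (LinearMap.ker f) + natLength R (LinearMap.range f) = natLength R N := by
  rw [← natLength_quotient_add (LinearMap.ker f), f.quotKerEquivRange.natLength_eq]

lemma natLength_strictMono {N : Type u} [AddCommGroup N] [Module R N] [Module.Finite R N]
    {P Q : Submodule R N} (h : P < Q) : natLength R P < natLength R Q := by
  have := Submodule.height_strictMono h
  rw [← Module.length_submodule, ← Module.length_submodule, ← coe_natLength,
    ← coe_natLength] at this
  exact_mod_cast this

lemma natLength_of_free [Nontrivial R] (N : Type u) [AddCommGroup N] [Module R N]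
    [Module.Free R N] [Module.Finite R N] :
    natLength R N = Module.finrank R N * natLength R R := by
  have := Module.length_of_free_of_finite (R := R) (M := N)
  simp only [← coe_natLength] at this
  exact_mod_cast this

lemma natLength_quotient_smul_top [Nontrivial R] (I : Ideal R) (N : Type u) [AddCommGroup N]
    [Module R N] [Module.Free R N] [Module.Finite R N] :
    natLength R (N ⧸ (I • ⊤ : Submodule R N)) = Module.finrank R N * natLength R (R ⧸ I) := by
  let b := Module.Free.chooseBasis R N
  have e := (TensorProduct.quotTensorEquivQuotSMul N I).symm ≪≫ₗ
    (b.repr.lTensor (R ⧸ I)) ≪≫ₗ TensorProduct.finsuppScalarRight R R (R ⧸ I) _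
  have h := e.length_eq
  rw [Module.length_finsupp, ENat.card_eq_coe_fintype_card,
    ← Module.finrank_eq_card_chooseBasisIndex, ← coe_natLength, ← coe_natLength] at h
  exact_mod_cast h

lemma natLength_smul_top [Nontrivial R] (I : Ideal R) (N : Type u) [AddCommGroup N]
    [Module R N] [Module.Free R N] [Module.Finite R N] :
    natLength R (I • ⊤ : Submodule R N) = Module.finrank R N * natLength R I := by
  have h := natLength_quotient_add (I • ⊤ : Submodule R N)
  rw [natLength_quotient_smul_top, natLength_of_free N, ← natLength_quotient_add I,
    mul_add] at h
  omega

end FiniteLength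

/-! ### The Hilbert function of an Artinian local ring -/

section LocalArtinian

variable (R : Type u) [CommRing R] [IsLocalRing R]

/-- The Hilbert function of the local ring `R`: the length of `𝔪 ^ a / 𝔪 ^ (a + 1)`. -/
noncomputable def hilbertFn (a : ℕ) : ℤ :=
  natLength R ↥(maximalIdeal R ^ a) - natLength R ↥(maximalIdeal R ^ (a + 1))

variable [IsArtinianRing R]

lemma natLength_grPiece (a : ℕ) (N : Type u) [AddCommGroup N] [Module R N] [Module.Free R N]
    [Module.Finite R N] :
    (natLength R (GrPiece R a N) : ℤ) = Module.finrank R N * hilbertFn R a := by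
  have hle : madicFiltration R (a + 1) N ≤ madicFiltration R a N :=
    Submodule.smul_mono (Ideal.pow_le_pow_right (by omega)) le_rfl
  have h := natLength_quotient_add
    ((madicFiltration R (a + 1) N).submoduleOf (madicFiltration R a N))
  rw [(Submodule.submoduleOfEquivOfLe hle).natLength_eq] at h
  have h1 : natLength R (madicFiltration R a N) =
      Module.finrank R N * natLength R ↥(maximalIdeal R ^ a) := natLength_smul_top _ N
  have h2 : natLength R (madicFiltration R (a + 1) N) =
      Module.finrank R N * natLength R ↥(maximalIdeal R ^ (a + 1)) := natLength_smul_top _ N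
  rw [h1, h2] at h
  rw [hilbertFn, mul_sub]
  push_cast [← @Nat.cast_inj ℤ] at h
  linarith

lemma hilbertFn_nonneg (a : ℕ) : 0 ≤ hilbertFn R a := by
  rw [hilbertFn, sub_nonneg, Nat.cast_le]
  rcases (Ideal.pow_le_pow_right (I := maximalIdeal R) (Nat.le_succ a)).eq_or_lt with h | h
  · exact (congrArg (fun I : Ideal R => natLength R I) h).le
  · exact (natLength_strictMono h).le

lemma hilbertFn_zero_pos : 0 < hilbertFn R 0 := by
  rw [hilbertFn, sub_pos, Nat.cast_lt]
  refine natLength_strictMono ?_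
  rw [zero_add, pow_zero, pow_one, Ideal.one_eq_top]
  exact lt_top_iff_ne_top.mpr (maximalIdeal.isMaximal R).ne_top

variable {R}

/-- Equality of lengths forces `𝔪² = 𝔪`, and Nakayama's lemma applies. -/
lemma maximalIdeal_eq_bot_of_hilbertFn_one_eq_zero (h : hilbertFn R 1 = 0) :
    maximalIdeal R = ⊥ := by
  have h2 : maximalIdeal R ^ (1 + 1) = maximalIdeal R ^ 1 := by
    refine eq_of_le_of_not_lt (Ideal.pow_le_pow_right (by omega)) fun hlt => ?_
    have := natLength_strictMono hlt
    rw [hilbertFn] at h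
    omega
  refine Submodule.eq_bot_of_le_smul_of_le_jacobson_bot (maximalIdeal R) (maximalIdeal R)
    (IsNoetherian.noetherian _) ?_ (maximalIdeal_le_jacobson ⊥)
  rw [smul_eq_mul, ← pow_two]
  simpa using h2.ge

lemma hilbertFn_eq_zero_of_hilbertFn_one_eq_zero (h : hilbertFn R 1 = 0) {a : ℕ} (ha : 0 < a) :
    hilbertFn R a = 0 := by
  have hm := maximalIdeal_eq_bot_of_hilbertFn_one_eq_zero h
  rw [hilbertFn, hm, Ideal.bot_pow ha.ne', Ideal.bot_pow a.succ_ne_zero, sub_self]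

end LocalArtinian

/-! ### Euler characteristics -/

section ExactComplex

variable {R : Type u} [CommRing R] [IsArtinianRing R]

lemma natLength_X_eq_of_isZero_homology (C : ChainComplex (ModuleCat.{u} R) ℕ) (i : ℕ)
    [Module.Finite R (C.X (i + 1))] (h : Limits.IsZero (C.homology (i + 1))) :
    natLength R (C.X (i + 1)) = natLength R (LinearMap.range (C.d (i + 2) (i + 1)).hom) +
      natLength R (LinearMap.range (C.d (i + 1) i).hom) := by
  rw [← HomologicalComplex.exactAt_iff_isZero_homology,
    HomologicalComplex.exactAt_iff' _ (i + 2) (i + 1) i (by simp) (by simp)] at h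
  have hr : LinearMap.range (C.d (i + 2) (i + 1)).hom = LinearMap.ker (C.d (i + 1) i).hom :=
    h.moduleCat_range_eq_ker
  rw [hr, natLength_ker_add_range]

/-- The Euler characteristic of an exact complex `0 → C₄ → C₃ → C₂ → C₁ → 0` vanishes. -/
lemma natLength_eq_of_four_term_exact (C : ChainComplex (ModuleCat.{u} R) ℕ) (i : ℕ)
    (hfin : ∀ l, Module.Finite R (C.X l)) (h : ∀ l > i, Limits.IsZero (C.homology l))
    (h0 : Subsingleton (C.X i)) (h5 : Subsingleton (C.X (i + 5))) :
    natLength R (C.X (i + 4)) + natLength R (C.X (i + 2)) =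
      natLength R (C.X (i + 3)) + natLength R (C.X (i + 1)) := by
  let r (l : ℕ) : ℕ := natLength R (LinearMap.range (C.d (l + 1) l).hom)
  have e (l : ℕ) (hl : i ≤ l) : natLength R (C.X (l + 1)) = r (l + 1) + r l :=
    natLength_X_eq_of_isZero_homology C l (h _ (by omega))
  have e1 : natLength R (C.X (i + 1)) = r (i + 1) + r i := e i (by omega)
  have e2 : natLength R (C.X (i + 2)) = r (i + 2) + r (i + 1) := e (i + 1) (by omega)
  have e3 : natLength R (C.X (i + 3)) = r (i + 3) + r (i + 2) := e (i + 2) (by omega)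
  have e4 : natLength R (C.X (i + 4)) = r (i + 4) + r (i + 3) := e (i + 3) (by omega)
  -- The outer ranks vanish: one map lands in a zero module, the other starts from one. The
  -- alternating sum of the lengths then telescopes to zero.
  have r0 : r i = 0 := natLength_eq_zero _
  have r4 : r (i + 4) = 0 := by
    have := (C.d (i + 5) (i + 4)).hom.surjective_rangeRestrict.subsingleton
    exact natLength_eq_zero _
  omega

end ExactComplex

lemma IsEventuallyPeriodicOfPeriod.not_eventually_eq_succ {b : ℕ → ℕ} {p : ℕ}
    (h : IsEventuallyPeriodicOfPeriod b p) (hp : 1 < p) : ¬ ∀ᶠ i in atTop, b (i + 1) = b i :=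
  fun h1 => hp.not_ge (h.2 ⟨one_pos, h1⟩)

/-! ### Periodic solutions of the recurrence -/

section Recurrence

lemma period_two_recurrence {e₀ e f g x y : ℤ} (he₀ : 0 < e₀) (he : 0 ≤ e) (hf : 0 ≤ f)
    (hg : 0 ≤ g) (h1 : e₀ * x + f * x = e * y + g * y) (h2 : e₀ * y + f * y = e * x + g * x) :
    x = y := by
  have h : (e₀ + e + f + g) * (x - y) = 0 := by linear_combination h1 - h2
  rcases mul_eq_zero.mp h with h | h <;> omega

/-- The differences `x - y` and `y - z` solve a 2×2 linear system whose determinant is the norm of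
`(e₀ - g) + fω - eω²`, with `ω` a primitive cube root of unity. This norm is nonzero under the sign
conditions and `heg`. -/
lemma period_three_recurrence {e₀ e f g x y z : ℤ} (he₀ : 0 < e₀) (he : 0 ≤ e) (hf : 0 ≤ f)
    (heg : e = 0 → g = 0) (h1 : e₀ * x + f * y = e * z + g * x)
    (h2 : e₀ * y + f * z = e * x + g * y) (h3 : e₀ * z + f * x = e * y + g * z) : x = y := by
  -- Cramer's rule, eliminating `y - z`.
  have hu : ((e₀ - g) ^ 2 + (e₀ - g) * (e - f) + (e ^ 2 + e * f + f ^ 2)) * (x - y) = 0 := by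
    linear_combination (e₀ - g - f) * (h1 - h2) - (e + f) * (h2 - h3)
  rcases mul_eq_zero.mp hu with h | h
  -- Completing the square shows that the norm is positive semidefinite.
  · have hs : (2 * (e₀ - g) + e - f) ^ 2 + 3 * (e + f) ^ 2 = 0 := by linear_combination 4 * h
    have hef : e + f = 0 := by
      have := sq_nonneg (2 * (e₀ - g) + e - f)
      exact pow_eq_zero_iff two_ne_zero |>.mp (le_antisymm (by linarith) (sq_nonneg _))
    obtain rfl : e = 0 := by omega
    obtain rfl : f = 0 := by omega
    obtain rfl := heg rfl
    have : e₀ ^ 2 = 0 := by linear_combination h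
    exact absurd this (by positivity)
  · omega

end Recurrence

/-! ### Betti numbers of eventually linear resolutions -/

namespace MinimalFreeResolution

variable {R : Type u} [CommRing R] [IsLocalRing R] {M : Type u} [AddCommGroup M] [Module R M]

lemma IsEventuallyLinear.exists_isZero_homology {F : MinimalFreeResolution R M}
    (hF : F.IsEventuallyLinear) : ∃ n : ℕ, ∀ i ≥ n, ∀ j : ℤ,
      Limits.IsZero ((grComplex F.resolution.complex F.minimal j).homology i) := by
  by_contra! h
  refine hF ?_
  simp only [linearityDefect, iInf_eq_top]
  intro n hn
  obtain ⟨i, hi, j, hij⟩ := h n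
  exact absurd (hn i hi j) hij

variable [IsArtinianRing R]

/-- The Betti numbers of an eventually linear resolution over a local ring with `𝔪 ^ 4 = 0`
eventually satisfy the recurrence with characteristic polynomial given by the Hilbert series. -/
lemma IsEventuallyLinear.eventually_betti_recurrence (hR : maximalIdeal R ^ 4 = ⊥)
    {F : MinimalFreeResolution R M} (hF : F.IsEventuallyLinear) :
    ∀ᶠ i in atTop, hilbertFn R 0 * F.betti (i + 3) + hilbertFn R 2 * F.betti (i + 1) =
      hilbertFn R 1 * F.betti (i + 2) + hilbertFn R 3 * F.betti i := by
  obtain ⟨n, hn⟩ := hF.exists_isZero_homology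
  refine eventually_atTop.mpr ⟨n + 1, fun k hk => ?_⟩
  -- The strand used lives in degrees `k` to `k + 3`; the shift makes room for the zero term in
  -- degree `k - 1`.
  obtain ⟨i, rfl⟩ : ∃ i, k = i + 1 := ⟨k - 1, by omega⟩
  have free := F.free
  have finite := F.finite
  let C := grComplex F.resolution.complex F.minimal ((i + 4 : ℕ) : ℤ)
  have length (a l : ℕ) (h : a + l = i + 4) :
      (natLength R (C.X l) : ℤ) = F.betti l * hilbertFn R a := by
    have ha : ((i + 4 : ℕ) : ℤ) - l = a := by omega
    change (natLength R (GrPiece R (((i + 4 : ℕ) : ℤ) - l) (F.resolution.complex.X l)) : ℤ) = _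
    rw [ha, natLength_grPiece, betti]
  have h0 : Subsingleton (C.X i) := by
    have ha : madicFiltration R (((i + 4 : ℕ) : ℤ) - i) (F.resolution.complex.X i) = ⊥ := by
      have : (((i + 4 : ℕ) : ℤ) - i).toNat = 4 := by omega
      rw [madicFiltration, this, hR, Submodule.bot_smul]
    have : Subsingleton
        (madicFiltration R (((i + 4 : ℕ) : ℤ) - i) (F.resolution.complex.X i)) := by
      rw [ha]; infer_instance
    exact (Submodule.mkQ_surjective _).subsingleton
  have h5 : Subsingleton (C.X (i + 5)) := by
    -- Here the exponent is `-1`, and `toNat` sends both `-1` and `0` to `0`, so the two filtration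
    -- steps coincide.
    refine Submodule.Quotient.subsingleton_iff.mpr ?_
    rw [Submodule.submoduleOf_eq_top]
    exact Submodule.smul_mono (Ideal.pow_le_pow_right (by omega)) le_rfl
  have hfin (l : ℕ) : Module.Finite R (C.X l) :=
    inferInstanceAs (Module.Finite R (GrPiece R _ _))
  have := natLength_eq_of_four_term_exact C i hfin (fun l hl => hn l (by omega) _) h0 h5
  push_cast [← @Nat.cast_inj ℤ] at this
  rw [length 0 (i + 4) (by omega), length 1 (i + 3) (by omega), length 2 (i + 2) (by omega),
    length 3 (i + 1) (by omega)] at this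
  linear_combination this

end MinimalFreeResolution

theorem theoremA (R : Type u) [CommRing R] [IsLocalRing R] [IsNoetherianRing R]
    (hR : maximalIdeal R ^ 4 = ⊥)
    (M : Type u) [AddCommGroup M] [Module R M] [Module.Finite R M]
    (F : MinimalFreeResolution R M) (hF : F.IsEventuallyLinear)
    (hExt : ∀ᶠ i : ℕ in atTop,
      Subsingleton (Abelian.Ext (ModuleCat.of R M) (ModuleCat.of R R) i)) :
    ¬ IsEventuallyPeriodicOfPeriod F.betti 2 ∧ ¬ IsEventuallyPeriodicOfPeriod F.betti 3 := by
  have : IsArtinianRing R := by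
    rw [isArtinianRing_iff_isNilpotent_maximalIdeal]
    exact ⟨4, hR⟩
  have hrec := hF.eventually_betti_recurrence hR
  have he₀ := hilbertFn_zero_pos R
  have nonneg := hilbertFn_nonneg R
  constructor
  · intro h
    refine h.not_eventually_eq_succ (by norm_num) ?_
    obtain ⟨n, hn⟩ := eventually_atTop.mp (hrec.and h.1.2)
    refine eventually_atTop.mpr ⟨n, fun i hi => ?_⟩
    obtain ⟨r0, p0⟩ := hn i hi
    obtain ⟨r1, p1⟩ := hn (i + 1) (by omega)
    have p2 := (hn (i + 2) (by omega)).2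
    simp only [add_assoc, Nat.reduceAdd] at *
    -- Periodicity leaves only `b (i + 1)` and `b i`, in the roles of `x` and `y`.
    rw [p1, p0] at r0
    rw [p2, p1, p0] at r1
    exact_mod_cast period_two_recurrence he₀ (nonneg 1) (nonneg 2) (nonneg 3) r0 r1
  · intro h
    refine h.not_eventually_eq_succ (by norm_num) ?_
    obtain ⟨n, hn⟩ := eventually_atTop.mp (hrec.and h.1.2)
    refine eventually_atTop.mpr ⟨n, fun i hi => ?_⟩
    obtain ⟨r0, p0⟩ := hn i hi
    obtain ⟨r1, p1⟩ := hn (i + 1) (by omega)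
    obtain ⟨r2, p2⟩ := hn (i + 2) (by omega)
    simp only [add_assoc, Nat.reduceAdd] at *
    rw [p0] at r0
    rw [p1, p0] at r1
    rw [p2, p1, p0] at r2
    have heg : hilbertFn R 1 = 0 → hilbertFn R 3 = 0 := fun h1 =>
      hilbertFn_eq_zero_of_hilbertFn_one_eq_zero h1 (by norm_num)
    exact_mod_cast (period_three_recurrence he₀ (nonneg 1) (nonneg 2) heg r0 r1 r2).symm
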